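/- Let $m,n\ge 0$ and let $\mathcal Z=\mathbb R^m\times\mathbb R^n\times \boldsymbol S^n_{++}$, where $\boldsymbol S^n$ is the space of real symmetric $n\times n$ matrices and $\boldsymbol S^n_{++}$ its open subset of positive definite matrices. For $\Sigma\in \boldsymbol S^n_{++}$ and $V\in\boldsymbol S^n$ let $\mathbf L_\Sigma[V]\in\boldsymbol S^n$ be the unique solution $H$ of $H\Sigma+\Sigma H=V$. Equip $\mathcal Z$ with the Riemannian metric $$\langle (w_1,v_1,V_1),(w_2,v_2,V_2)\rangle_z=\langle w_1,w_2\rangle+\langle v_1,v_2\rangle+\operatorname{tr}\big(\mathbf L_\Sigma[V_1]\,\Sigma\,\mathbf L_\Sigma[V_2]\big),\qquad z=(x,\mu,\Sigma),$$ on the tangent spaces $\mathbb R^m\times\mathbb R^n\times\boldsymbol S^n$ (its distance function $d$ is the product of the Euclidean distances and the Bures distance), with norm $\|\cdot\|_z$, gradient $\widetilde\nabla_d$, and exponential map $$\exp_z(w,v,V)=\big(x+w,\ \mu+v,\ (I+\mathbf L_\Sigma[V])\,\Sigma\,(I+\mathbf L_\Sigma[V])\big),$$ which is defined for those $(w,v,V)$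 for which $I+\mathbf L_\Sigma[V]$ is positive definite. For $L>0$, a kernel $k:\mathcal Z\times\mathcal Z\to\mathbb R$ that is differentiable on $\mathcal Z\times\mathcal Z$ is called a *Lipschitz-gradient kernel with constant $L$* if there is $\varepsilon_0\in(0,1)$ such that $$\Big|k\big(\exp_z(\varepsilon\Phi(z)),\exp_w(\delta\Phi(w))\big)-k(z,w)-\big[\langle\widetilde\nabla^1_dk(z,w),\varepsilon\Phi(z)\rangle_z+\langle\widetilde\nabla^2_dk(z,w),\delta\Phi(w)\rangle_w\big]\Big|\le L\big[\|\varepsilon\Phi(z)\|_z^2+\|\delta\Phi(w)\|_w^2\big]$$ for all $\varepsilon,\delta\in[0,\varepsilon_0]$, all bounded vector fields $\Phi:\mathcal Z\to\mathbb R^m\times\mathbb R^n\times\boldsymbol S^n$ and all $z,w\in\mathcal Z$ for which both exponentials are defined. Here $\widetilde\nabla^1_dk$ and $\widetilde\nabla^2_dk$ are the gradients of $k$ in its first and in its second argument, and $\Phi$ is bounded if $\sup_{z\in\mathcal Z}\|\Phi(z)\|_z<\infty$. **Lemma.** Let $k$ be a positive definite kernel on $\mathcal Z$ (that is, $k$ is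 symmetric and $\sum_{i,j}c_ic_jk(z_i,z_j)\ge0$ for all finite families $z_i\in\mathcal Z$, $c_i\in\mathbb R$) which is twice differentiable on $\mathcal Z\times\mathcal Z$. Suppose that its Riemannian Hessian, as a function on the product Riemannian manifold $\mathcal Z\times\mathcal Z$, is bounded: there is $M\in\mathbb R$ such that $$|\operatorname{Hess}k(p)(\xi,\eta)|\le M\,\|\xi\|_p\,\|\eta\|_p$$ for all $p\in\mathcal Z\times\mathcal Z$ and all tangent vectors $\xi,\eta$ at $p$. Then $k$ is a Lipschitz-gradient kernel with some constant $L>0$; and if $M>0$ (for example, if $M$ is the sup norm of the Hessian and is not zero), then it is a Lipschitz-gradient kernel with constant $M/2$. -/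

import Mathlib

/- Every norm on a finite-dimensional space gives the same derivatives; the entrywise norm on
matrices is only used to have one at hand. -/
open scoped Matrix.Norms.Elementwise

namespace BuresKernel

/-! ### Riemannian notions for a metric given in one global linear chart

`F` is a finite-dimensional space, and `g p ξ η` is a Riemannian metric at the point `p` of an open
subset of `F`, evaluated at the tangent vectors `ξ η : F`. -/

section Chart

variable {F : Type*} [NormedAddCommGroup F] [NormedSpace ℝ F]

/-- `X` represents the linear form `ℓ` with respect to the inner product `g p`. -/
def Represents (g : F → F → F → ℝ) (p : F) (ℓ : F → ℝ) (X : F) : Prop :=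
  ∀ η, g p X η = ℓ η

/-- The vector that represents the linear form `ℓ` with respect to `g p` (raising an index). -/
noncomputable def sharp (g : F → F → F → ℝ) (p : F) (ℓ : F → ℝ) : F :=
  Classical.epsilon (Represents g p ℓ)

/-- For an inner product on a finite-dimensional space, `sharp g p ℓ` is the unique vector that
represents `ℓ`. -/
theorem sharp_spec [FiniteDimensional ℝ F] (g : F → F → F → ℝ) (p : F) (B : F →ₗ[ℝ] F →ₗ[ℝ] ℝ)
    (hg : ∀ ξ η, g p ξ η = B ξ η) (hB : ∀ ξ, ξ ≠ 0 → 0 < B ξ ξ) (ℓ : F →ₗ[ℝ] ℝ) :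
    Represents g p ℓ (sharp g p ℓ) ∧ ∀ X, Represents g p ℓ X → X = sharp g p ℓ := by
  have hinj : Function.Injective B := by
    rw [injective_iff_map_eq_zero]
    intro ξ h
    by_contra h0
    have h1 := hB ξ h0
    simp [h] at h1
  have hsurj : Function.Surjective B :=
    (LinearMap.injective_iff_surjective_of_finrank_eq_finrank
      (Subspace.dual_finrank_eq (K := ℝ) (V := F)).symm).mp hinj
  have hex : ∃ X, Represents g p ℓ X := by
    obtain ⟨X, hX⟩ := hsurj ℓ
    exact ⟨X, fun η => by rw [hg, hX]⟩
  have hs : Represents g p ℓ (sharp g p ℓ) := Classical.epsilon_spec hex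
  refine ⟨hs, fun X hX => hinj (LinearMap.ext fun η => ?_)⟩
  rw [← hg, ← hg, hX, hs]

/-- The Riemannian gradient: the vector `X` with `g p X η = D f p η` for all `η`. -/
noncomputable def riemGrad (g : F → F → F → ℝ) (f : F → ℝ) (p : F) : F :=
  sharp g p (fun η => fderiv ℝ f p η)

/-- Christoffel symbols of the first kind:
`(∂_ξ g(η, ζ) + ∂_η g(ξ, ζ) - ∂_ζ g(ξ, η)) / 2` for constant vectors `ξ η ζ`. -/
noncomputable def christoffelFirst (g : F → F → F → ℝ) (p ξ η ζ : F) : ℝ :=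
  (fderiv ℝ (fun q => g q η ζ) p ξ + fderiv ℝ (fun q => g q ξ ζ) p η
    - fderiv ℝ (fun q => g q ξ η) p ζ) / 2

/-- Christoffel symbols of the second kind: the Levi-Civita derivative `∇_ξ η` of the constant
vector field `η` in the direction `ξ`. -/
noncomputable def christoffel (g : F → F → F → ℝ) (p ξ η : F) : F :=
  sharp g p (christoffelFirst g p ξ η)

/-- The Riemannian Hessian (of the Levi-Civita connection):
`Hess f (ξ, η) = D² f (ξ, η) - D f (∇_ξ η)`, that is `∂ᵢ∂ⱼ f - Γᵏᵢⱼ ∂ₖ f` in coordinates. -/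
noncomputable def riemHess (g : F → F → F → ℝ) (f : F → ℝ) (p ξ η : F) : ℝ :=
  fderiv ℝ (fderiv ℝ f) p ξ η - fderiv ℝ f p (christoffel g p ξ η)

/-- The norm of a tangent vector. -/
noncomputable def tnorm (g : F → F → F → ℝ) (p ξ : F) : ℝ := Real.sqrt (g p ξ ξ)

/-- The product metric on pairs of points. -/
def prodMetric (g : F → F → F → ℝ) (p ξ η : F × F) : ℝ :=
  g p.1 ξ.1 η.1 + g p.2 ξ.2 η.2

/-- Twice (Fréchet) differentiable at the points of the open set `s`. -/
def TwiceDifferentiableOn (f : F → ℝ) (s : Set F) : Prop :=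
  ∀ p ∈ s, DifferentiableAt ℝ f p ∧ DifferentiableAt ℝ (fderiv ℝ f) p

/-- The operator norm of the Riemannian Hessian of `f` is at most `M` at every point of `s`. -/
def HessianBoundedOn (g : F → F → F → ℝ) (f : F → ℝ) (s : Set F) (M : ℝ) : Prop :=
  ∀ p ∈ s, ∀ ξ η, |riemHess g f p ξ η| ≤ M * tnorm g p ξ * tnorm g p η

end Chart

/-! ### The manifold -/

/-- Real symmetric matrices. -/
def symSubmodule (n : ℕ) : Submodule ℝ (Matrix (Fin n) (Fin n) ℝ) where
  carrier := {A | A.IsSymm}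
  add_mem' ha hb := Matrix.IsSymm.add ha hb
  zero_mem' := Matrix.isSymm_zero
  smul_mem' c _ ha := Matrix.IsSymm.smul ha c

/-- The space of real symmetric `n × n` matrices. -/
abbrev SymMat (n : ℕ) : Type := symSubmodule n

theorem SymMat.isSymm {n : ℕ} (A : SymMat n) : (A : Matrix (Fin n) (Fin n) ℝ).IsSymm := A.2

/-- The Lyapunov operator `H ↦ H Σ + Σ H` on symmetric matrices. -/
noncomputable def lyapOp {n : ℕ} (S : SymMat n) : SymMat n →L[ℝ] SymMat n :=
  LinearMap.toContinuousLinearMap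
    { toFun := fun H => ⟨H.1 * S.1 + S.1 * H.1, by
        change (H.1 * S.1 + S.1 * H.1).transpose = _
        rw [Matrix.transpose_add, Matrix.transpose_mul, Matrix.transpose_mul,
          H.isSymm.eq, S.isSymm.eq, add_comm]⟩
      map_add' := fun A B => by
        ext1; simp [add_mul, mul_add]; abel
      map_smul' := fun c A => by
        ext1; simp }

/-- The solution operator `L_Σ` of the Lyapunov equation `H Σ + Σ H = V`
(see `lyap_spec` and `lyap_unique`). -/
noncomputable def lyap {n : ℕ} (S : SymMat n) : SymMat n →L[ℝ] SymMat n := Ring.inverse (lyapOp S)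

theorem lyapOp_apply {n : ℕ} (S H : SymMat n) :
    ((lyapOp S H : SymMat n) : Matrix (Fin n) (Fin n) ℝ) = H.1 * S.1 + S.1 * H.1 := rfl

theorem trace_mul_mul_pos {n : ℕ} (S H : SymMat n)
    (hS : (S : Matrix (Fin n) (Fin n) ℝ).PosDef) (hH : H ≠ 0) :
    0 < Matrix.trace (H.1 * S.1 * H.1) := by
  have h1 : (H.1 * S.1 * H.1).PosSemidef := by
    have := hS.posSemidef.mul_mul_conjTranspose_same H.1
    rwa [Matrix.conjTranspose_eq_transpose_of_trivial, H.isSymm.eq] at this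
  refine lt_of_le_of_ne h1.trace_nonneg (fun h0 => hH ?_)
  have h2 : H.1 * S.1 * H.1 = 0 := h1.trace_eq_zero_iff.mp h0.symm
  have h3 : ∀ x, H.1.mulVec x = 0 := by
    intro x
    by_contra hx
    have h4 := hS.dotProduct_mulVec_pos hx
    have h5 : star (H.1.mulVec x) ⬝ᵥ (S.1.mulVec (H.1.mulVec x))
        = x ⬝ᵥ ((H.1 * S.1 * H.1).mulVec x) := by
      rw [star_trivial, ← Matrix.mulVec_mulVec, ← Matrix.mulVec_mulVec,
        Matrix.dotProduct_mulVec x, ← Matrix.mulVec_transpose, H.isSymm.eq]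
    rw [h5, h2] at h4
    simp at h4
  ext1
  exact Matrix.ext_of_mulVec_single fun i => (h3 _).trans (Matrix.zero_mulVec _).symm

theorem lyapOp_isUnit {n : ℕ} (S : SymMat n) (hS : (S : Matrix (Fin n) (Fin n) ℝ).PosDef) :
    IsUnit (lyapOp S) := by
  have hinj : Function.Injective (lyapOp S) := by
    rw [injective_iff_map_eq_zero]
    intro H hH
    by_contra h0
    have h1 : H.1 * S.1 + S.1 * H.1 = 0 := by
      rw [← lyapOp_apply, hH]; rfl
    have h2 := trace_mul_mul_pos S H hS h0
    have h3 : Matrix.trace (H.1 * (H.1 * S.1 + S.1 * H.1)) = 0 := by simp [h1]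
    rw [mul_add, Matrix.trace_add, ← Matrix.mul_assoc, ← Matrix.mul_assoc,
      Matrix.trace_mul_comm (H.1 * H.1), ← Matrix.mul_assoc,
      Matrix.trace_mul_comm (S.1 * H.1), ← Matrix.mul_assoc] at h3
    linarith
  have hsurj : Function.Surjective (lyapOp S) :=
    (LinearMap.injective_iff_surjective (f := (lyapOp S).toLinearMap)).mp hinj
  exact ContinuousLinearMap.isUnit_iff_bijective.mpr ⟨hinj, hsurj⟩

theorem lyap_spec {n : ℕ} (S V : SymMat n) (hS : (S : Matrix (Fin n) (Fin n) ℝ).PosDef) :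
    (lyap S V).1 * S.1 + S.1 * (lyap S V).1 = V.1 := by
  have h := Ring.mul_inverse_cancel _ (lyapOp_isUnit S hS)
  have h2 : lyapOp S (lyap S V) = V := congrArg (fun T : SymMat n →L[ℝ] SymMat n => T V) h
  rw [← lyapOp_apply, h2]

theorem lyap_unique {n : ℕ} (S V H : SymMat n) (hS : (S : Matrix (Fin n) (Fin n) ℝ).PosDef)
    (hH : H.1 * S.1 + S.1 * H.1 = V.1) : H = lyap S V := by
  have h := Ring.inverse_mul_cancel _ (lyapOp_isUnit S hS)
  have h1 : lyapOp S H = V := Subtype.ext hH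
  have h2 : lyap S (lyapOp S H) = H := congrArg (fun T : SymMat n →L[ℝ] SymMat n => T H) h
  rw [← h2, h1]

/-- The vector space `ℝᵐ × ℝⁿ × Sⁿ`: the tangent space at each point of the manifold `Z`. -/
abbrev Ambient (m n : ℕ) : Type :=
  EuclideanSpace ℝ (Fin m) × EuclideanSpace ℝ (Fin n) × SymMat n

/-- The manifold `ℝᵐ × ℝⁿ × Sⁿ₊₊`, an open subset of `Ambient m n`. -/
def Z (m n : ℕ) : Set (Ambient m n) := {z | (z.2.2 : Matrix (Fin n) (Fin n) ℝ).PosDef}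

/-- The Riemannian metric
`⟨w₁, w₂⟩ + ⟨v₁, v₂⟩ + tr (L_Σ[V₁] Σ L_Σ[V₂])` at `z = (x, μ, Σ)`. -/
noncomputable def zMetric {m n : ℕ} (z ξ η : Ambient m n) : ℝ :=
  inner ℝ ξ.1 η.1 + inner ℝ ξ.2.1 η.2.1 +
    Matrix.trace ((lyap z.2.2 ξ.2.2).1 * z.2.2.1 * (lyap z.2.2 η.2.2).1)

/-- The metric at `z` as a bilinear form. -/
noncomputable def zMetricBilin {m n : ℕ} (z : Ambient m n) :
    Ambient m n →ₗ[ℝ] Ambient m n →ₗ[ℝ] ℝ :=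
  LinearMap.mk₂ ℝ (zMetric z)
    (fun a b c => by
      simp only [zMetric, Prod.fst_add, Prod.snd_add, inner_add_left, map_add,
        Submodule.coe_add, add_mul, Matrix.trace_add]
      ring)
    (fun r a c => by
      simp only [zMetric, Prod.smul_fst, Prod.smul_snd, real_inner_smul_left, map_smul,
        Submodule.coe_smul, Matrix.smul_mul, Matrix.trace_smul, smul_eq_mul]
      ring)
    (fun a b c => by
      simp only [zMetric, Prod.fst_add, Prod.snd_add, inner_add_right, map_add,
        Submodule.coe_add, mul_add, Matrix.trace_add]
      ring)
    (fun r a c => by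
      simp only [zMetric, Prod.smul_fst, Prod.smul_snd, real_inner_smul_right, map_smul,
        Submodule.coe_smul, Matrix.mul_smul, Matrix.trace_smul, smul_eq_mul]
      ring)

theorem zMetric_pos {m n : ℕ} (z : Ambient m n) (hz : z ∈ Z m n) (ξ : Ambient m n) (hξ : ξ ≠ 0) :
    0 < zMetric z ξ ξ := by
  have h1 : 0 ≤ inner ℝ ξ.1 ξ.1 := real_inner_self_nonneg
  have h2 : 0 ≤ inner ℝ ξ.2.1 ξ.2.1 := real_inner_self_nonneg
  have h3 : lyap z.2.2 ξ.2.2 = 0 → ξ.2.2 = 0 := by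
    intro h
    have h4 := lyap_spec z.2.2 ξ.2.2 hz
    rw [h] at h4
    ext1
    simpa using h4.symm
  unfold zMetric
  by_cases h : lyap z.2.2 ξ.2.2 = 0
  · have h5 : ¬ (ξ.1 = 0 ∧ ξ.2.1 = 0) := fun h6 =>
      hξ (Prod.ext h6.1 (Prod.ext h6.2 (h3 h)))
    have h7 : Matrix.trace ((lyap z.2.2 ξ.2.2).1 * z.2.2.1 * (lyap z.2.2 ξ.2.2).1) = 0 := by
      simp [h]
    rw [h7]
    by_cases h8 : ξ.1 = 0
    · have h9 : 0 < inner ℝ ξ.2.1 ξ.2.1 := real_inner_self_pos.mpr fun h10 => h5 ⟨h8, h10⟩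
      linarith
    · have h9 : 0 < inner ℝ ξ.1 ξ.1 := real_inner_self_pos.mpr h8
      linarith
  · have := trace_mul_mul_pos z.2.2 _ hz h
    linarith

/-- The matrix `I + L_Σ[V]`. -/
noncomputable def expFactor {n : ℕ} (S V : SymMat n) : Matrix (Fin n) (Fin n) ℝ :=
  1 + (lyap S V).1

theorem expFactor_isSymm {n : ℕ} (S V : SymMat n) : (expFactor S V).IsSymm :=
  Matrix.isSymm_one.add (lyap S V).isSymm

/-- The domain of the exponential map at `z`: the tangent vectors `(w, v, V)` such that
`I + L_Σ[V]` is positive definite. -/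
def expDomain {m n : ℕ} (z : Ambient m n) : Set (Ambient m n) :=
  {ξ | (expFactor z.2.2 ξ.2.2).PosDef}

/-- The exponential map
`exp_z (w, v, V) = (x + w, μ + v, (I + L_Σ[V]) Σ (I + L_Σ[V]))`, for `(w, v, V) ∈ expDomain z`. -/
noncomputable def expMap {m n : ℕ} (z ξ : Ambient m n) : Ambient m n :=
  (z.1 + ξ.1, z.2.1 + ξ.2.1,
    ⟨expFactor z.2.2 ξ.2.2 * z.2.2.1 * expFactor z.2.2 ξ.2.2, by
      change (expFactor z.2.2 ξ.2.2 * z.2.2.1 * expFactor z.2.2 ξ.2.2).transpose = _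
      rw [Matrix.transpose_mul, Matrix.transpose_mul, (expFactor_isSymm _ _).eq,
        z.2.2.isSymm.eq, Matrix.mul_assoc]⟩)

/-! ### Kernels

A kernel on `Z m n` is given by a function on pairs of points of `Ambient m n`; only its values on
`Z m n` play a role below. -/

/-- A positive definite kernel on `Z`: symmetric, and `∑ᵢⱼ cᵢ cⱼ k(zᵢ, zⱼ) ≥ 0` for every finite
family of points of `Z` and of real coefficients. -/
def IsPositiveDefiniteKernel {m n : ℕ} (k : Ambient m n → Ambient m n → ℝ) : Prop :=
  (Matrix.of fun z w : Z m n => k z w).PosSemidef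

/-- A vector field on `Z` that is bounded in the Riemannian norm. -/
def IsBoundedField {m n : ℕ} (Φ : Ambient m n → Ambient m n) : Prop :=
  ∃ C : ℝ, ∀ z ∈ Z m n, tnorm zMetric z (Φ z) ≤ C

/-- Lipschitz-gradient kernel with constant `L`. The inequality is asserted whenever
`exp_z (ε Φ(z))` and `exp_w (δ Φ(w))` are defined. -/
def IsLipschitzGradientKernel {m n : ℕ} (k : Ambient m n → Ambient m n → ℝ) (L : ℝ) : Prop :=
  0 < L ∧
  (∀ p ∈ Z m n ×ˢ Z m n, DifferentiableAt ℝ (Function.uncurry k) p) ∧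
  ∃ ε₀ ∈ Set.Ioo (0 : ℝ) 1,
    ∀ ε ∈ Set.Icc 0 ε₀, ∀ δ ∈ Set.Icc 0 ε₀,
    ∀ Φ : Ambient m n → Ambient m n, IsBoundedField Φ →
    ∀ z ∈ Z m n, ∀ w ∈ Z m n,
      ε • Φ z ∈ expDomain z → δ • Φ w ∈ expDomain w →
      |k (expMap z (ε • Φ z)) (expMap w (δ • Φ w)) - k z w
          - (zMetric z (riemGrad zMetric (fun z' => k z' w) z) (ε • Φ z)
            + zMetric w (riemGrad zMetric (fun w' => k z w') w) (δ • Φ w))|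
        ≤ L * (tnorm zMetric z (ε • Φ z) ^ 2 + tnorm zMetric w (δ • Φ w) ^ 2)

end BuresKernel

open BuresKernel

/-! The inequality is a second-order Taylor estimate along a geodesic of the product manifold. The
curve `t ↦ (exp_z (tξ), exp_w (tη))` stays in `Z × Z` for `t ∈ [0, 1]`, has constant speed, and
satisfies the geodesic equation. Hence the second derivative of `k` along it is the Riemannian
Hessian on the velocity, of size at most `M (‖ξ‖² + ‖η‖²)`, and integrating twice gives the factor
`M / 2`.

The work is to check that the explicit `expMap` is geodesic for the Levi-Civita connection. With `H
= L_Σ[V]`, the curve `(1 + tH) Σ (1 + tH) = Σ + tV + t² HΣH` is quadratic in the chart with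
acceleration `2HΣH`. `christoffel_prodMetric_self` shows that the Christoffel term on a velocity is
`-2HΣH`, and `quadVec_expVelocity` that `HΣH` is conserved along the curve, so the two cancel.
Conservation of its trace gives constant speed (`zMetric_expVelocity`). -/

namespace BuresKernel

/-! ### Calculus in a linear chart -/

section Chart

variable {F : Type*} [NormedAddCommGroup F] [NormedSpace ℝ F]

/-- Only uniqueness is needed once a representing vector is known, so `ℓ` may be a bare function.
This lets Christoffel symbols be identified without first proving `christoffelFirst` linear in its
last slot. -/
theorem sharp_eq_of_represents (g : F → F → F → ℝ) (p : F) (B : F →ₗ[ℝ] F →ₗ[ℝ] ℝ)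
    (hg : ∀ ξ η, g p ξ η = B ξ η) (hB : ∀ ξ, ξ ≠ 0 → 0 < B ξ ξ) {ℓ : F → ℝ} {X : F}
    (hX : Represents g p ℓ X) : sharp g p ℓ = X := by
  have hs : Represents g p ℓ (sharp g p ℓ) := Classical.epsilon_spec ⟨X, hX⟩
  by_contra hne
  have h := hB (sharp g p ℓ - X) (sub_ne_zero.mpr hne)
  have h0 : B (sharp g p ℓ - X) = 0 := by
    ext η
    rw [map_sub, LinearMap.sub_apply, ← hg, ← hg, hs, hX, sub_self]; rfl
  rw [h0] at h
  exact lt_irrefl _ h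

/-- For `ξ = η` the right side is the second derivative of `f` along a curve with velocity `ξ` and
acceleration `2X`. -/
theorem riemHess_eq_of_christoffel_eq {g : F → F → F → ℝ} {p ξ η X : F}
    (h : christoffel g p ξ η = (-2 : ℝ) • X) (f : F → ℝ) :
    riemHess g f p ξ η = fderiv ℝ (fderiv ℝ f) p ξ η + fderiv ℝ f p ((2 : ℝ) • X) := by
  rw [riemHess, h, neg_smul, map_neg, sub_neg_eq_add]

/-- The derivative of `T ↦ (Λ T)⁻¹ V` for a linear family `Λ` of operators. -/
theorem hasFDerivAt_ringInverse_apply [CompleteSpace F] (Λ : F →L[ℝ] F →L[ℝ] F) (S V : F)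
    (hS : IsUnit (Λ S)) :
    ∃ D : F →L[ℝ] F, HasFDerivAt (fun T => Ring.inverse (Λ T) V) D S ∧
      ∀ X, D X = -Ring.inverse (Λ S) (Λ X (Ring.inverse (Λ S) V)) := by
  obtain ⟨u, hu⟩ := hS
  have h1 := hasFDerivAt_ringInverse (𝕜 := ℝ) u
  rw [hu] at h1
  have h2 := h1.comp S Λ.hasFDerivAt
  refine ⟨_, h2.clm_apply (hasFDerivAt_const V S), fun X => ?_⟩
  simp [← hu]

theorem isOpen_setOf_isUnit [CompleteSpace F] (Λ : F →L[ℝ] F →L[ℝ] F) :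
    IsOpen {T | IsUnit (Λ T)} :=
  Units.isOpen.preimage Λ.continuous

theorem hasDerivAt_quadratic (z ξ a : F) (t : ℝ) :
    HasDerivAt (fun s : ℝ => z + s • ξ + s ^ 2 • a) (ξ + (2 * t) • a) t := by
  have h2 : HasDerivAt (fun s : ℝ => z + s • ξ + s ^ 2 • a) _ t :=
    (((hasDerivAt_id t).smul_const ξ).const_add z).add ((hasDerivAt_pow 2 t).smul_const a)
  exact h2.congr_deriv (by simp)

theorem hasDerivAt_linear (ξ a : F) (t : ℝ) :
    HasDerivAt (fun s : ℝ => ξ + (2 * s) • a) ((2 : ℝ) • a) t := by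
  have h2 : HasDerivAt (fun s : ℝ => ξ + (2 * s) • a) _ t :=
    (((hasDerivAt_id t).const_mul 2).smul_const a).const_add ξ
  exact h2.congr_deriv (by simp)

end Chart

/-! ### The Lyapunov solution operator and its derivative -/

section Lyapunov

variable {n : ℕ}

/-- The Lyapunov operator as a continuous linear function of the matrix. -/
noncomputable def lyapOpCLM (n : ℕ) : SymMat n →L[ℝ] SymMat n →L[ℝ] SymMat n :=
  LinearMap.toContinuousLinearMap
    { toFun := lyapOp
      map_add' := fun A B => by
        ext1 H; ext1
        simp only [lyapOp_apply, add_apply, Submodule.coe_add, mul_add, add_mul]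
        abel
      map_smul' := fun c A => by
        ext1 H; ext1
        simp [lyapOp_apply] }

/-- Invertibility of `lyapOp S` replaces positive definiteness because it is visibly an open
condition, as differentiation in `S` requires. -/
theorem lyap_mul_add_mul_lyap (S V : SymMat n) (hS : IsUnit (lyapOp S)) :
    (lyap S V).1 * S.1 + S.1 * (lyap S V).1 = V.1 := by
  have h2 : lyapOp S (lyap S V) = V :=
    congrArg (fun T : SymMat n →L[ℝ] SymMat n => T V) (Ring.mul_inverse_cancel _ hS)
  rw [← lyapOp_apply, h2]

theorem hasFDerivAt_lyap (S V : SymMat n) (hS : IsUnit (lyapOp S)) :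
    ∃ D : SymMat n →L[ℝ] SymMat n, HasFDerivAt (fun T => lyap T V) D S ∧
      ∀ X, D X = -lyap S (lyapOp X (lyap S V)) :=
  hasFDerivAt_ringInverse_apply (lyapOpCLM n) S V hS

theorem trace_mul_mul_comm_of_isSymm {A B C : Matrix (Fin n) (Fin n) ℝ} (hA : A.IsSymm)
    (hB : B.IsSymm) (hC : C.IsSymm) : (A * B * C).trace = (C * B * A).trace := by
  rw [← Matrix.trace_transpose, Matrix.transpose_mul, Matrix.transpose_mul, hA.eq, hB.eq, hC.eq,
    Matrix.mul_assoc]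

/-- Substitute `W = KΣ + ΣK` with `K = L_Σ[W]`: by cyclicity and transposition both terms have the
same trace against `L_Σ[V]`. The metric then involves a single Lyapunov solution, which makes it
easy to differentiate. -/
theorem trace_lyap_mul_mul_lyap (S V W : SymMat n) (hS : IsUnit (lyapOp S)) :
    ((lyap S V).1 * S.1 * (lyap S W).1).trace = ((lyap S V).1 * W.1).trace / 2 := by
  have h := congrArg (fun A => ((lyap S V).1 * A).trace) (lyap_mul_add_mul_lyap S W hS)
  simp only [mul_add, Matrix.trace_add, ← Matrix.mul_assoc] at h
  have h1 := Matrix.trace_mul_cycle (lyap S V).1 (lyap S W).1 S.1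
  have h2 := trace_mul_mul_comm_of_isSymm (lyap S V).isSymm (lyap S W).isSymm S.isSymm
  have h3 := Matrix.trace_mul_cycle S.1 (lyap S W).1 (lyap S V).1
  linarith

theorem trace_lyap_mul_comm (S V W : SymMat n) (hS : IsUnit (lyapOp S)) :
    ((lyap S V).1 * W.1).trace = (V.1 * (lyap S W).1).trace := by
  have h1 := trace_lyap_mul_mul_lyap S V W hS
  have h2 := trace_lyap_mul_mul_lyap S W V hS
  have h3 := trace_mul_mul_comm_of_isSymm (lyap S V).isSymm S.isSymm (lyap S W).isSymm
  rw [Matrix.trace_mul_comm V.1]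
  linarith

theorem hasFDerivAt_trace_lyap (S V W : SymMat n) (hS : IsUnit (lyapOp S)) :
    ∃ D : SymMat n →L[ℝ] ℝ,
      HasFDerivAt (fun T : SymMat n => ((lyap T V).1 * T.1 * (lyap T W).1).trace) D S ∧
      ∀ X, D X = -((lyapOp X (lyap S V)).1 * (lyap S W).1).trace / 2 := by
  obtain ⟨D, hD, hDX⟩ := hasFDerivAt_lyap S V hS
  let φ : SymMat n →L[ℝ] ℝ := LinearMap.toContinuousLinearMap
    { toFun := fun H => (H.1 * W.1).trace / 2
      map_add' := fun A B => by simp [add_mul, Matrix.trace_add]; ring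
      map_smul' := fun c A => by simp [Matrix.trace_smul]; ring }
  have hφ : ∀ H, φ H = (H.1 * W.1).trace / 2 := fun H => rfl
  refine ⟨φ.comp D, ?_, fun X => ?_⟩
  · refine (φ.hasFDerivAt.comp S hD).congr_of_eventuallyEq ?_
    -- The halved-trace formula must hold near `S`, not just at `S`.
    have hopen := isOpen_setOf_isUnit (lyapOpCLM n)
    filter_upwards [hopen.mem_nhds hS] with T hT
    exact trace_lyap_mul_mul_lyap T V W hT
  · rw [ContinuousLinearMap.comp_apply, hDX, hφ, Submodule.coe_neg, neg_mul, Matrix.trace_neg,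
      trace_lyap_mul_comm S _ W hS]

end Lyapunov

/-! ### Christoffel symbols of the metric -/

section Metric

variable {m n : ℕ}

/-- The velocity-dependent acceleration term `L_Σ[V] Σ L_Σ[V]` of the geodesics. -/
noncomputable def quadTerm (S V : SymMat n) : SymMat n :=
  ⟨(lyap S V).1 * S.1 * (lyap S V).1, by
    change ((lyap S V).1 * S.1 * (lyap S V).1).transpose = _
    rw [Matrix.transpose_mul, Matrix.transpose_mul, (lyap S V).isSymm.eq, S.isSymm.eq,
      Matrix.mul_assoc]⟩

theorem quadTerm_coe (S V : SymMat n) :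
    (quadTerm S V).1 = (lyap S V).1 * S.1 * (lyap S V).1 := rfl

/-- The Bures part of the geodesic equation. -/
theorem trace_lyap_quadTerm (S V W : SymMat n) (hS : IsUnit (lyapOp S)) :
    ((lyap S ((-2 : ℝ) • quadTerm S V)).1 * S.1 * (lyap S W).1).trace =
      -((lyapOp V (lyap S V)).1 * (lyap S W).1).trace / 2 +
        ((lyapOp W (lyap S V)).1 * (lyap S V).1).trace / 4 := by
  rw [trace_lyap_mul_mul_lyap S _ W hS, trace_lyap_mul_comm S _ W hS, lyapOp_apply, lyapOp_apply]
  have hV := lyap_mul_add_mul_lyap S V hS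
  have hW := lyap_mul_add_mul_lyap S W hS
  have hK := (lyap S W).isSymm
  have hH := (lyap S V).isSymm
  have hS' := S.isSymm
  have hq : ((-2 : ℝ) • quadTerm S V).1 = (-2 : ℝ) • ((lyap S V).1 * S.1 * (lyap S V).1) := rfl
  rw [hq]
  generalize (lyap S V).1 = H at *
  generalize (lyap S W).1 = K at *
  generalize S.1 = T at *
  rw [← hV, ← hW]
  simp only [add_mul, mul_add, Matrix.trace_add, Matrix.smul_mul, Matrix.trace_smul, smul_eq_mul,
    ← Matrix.mul_assoc]
  -- After expansion, the traces of `HHTK` and `THHK` on the right cancel up to cyclic permutation,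
  -- leaving `-tr (HTHK)` on both sides.
  have e1 := Matrix.trace_mul_comm (H * K * T) H
  have e2 := Matrix.trace_mul_comm (H * T * K) H
  have e3 := Matrix.trace_mul_comm (K * T) (H * H)
  have e4 := Matrix.trace_mul_comm (T * K) (H * H)
  have e5 := Matrix.trace_mul_comm (H * H * K) T
  simp only [← Matrix.mul_assoc] at e1 e2 e3 e4 e5
  linarith

theorem hasFDerivAt_zMetric (z ξ η : Ambient m n) (hz : z ∈ Z m n) :
    ∃ D : Ambient m n →L[ℝ] ℝ, HasFDerivAt (fun q => zMetric q ξ η) D z ∧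
      ∀ ζ, D ζ = -((lyapOp ζ.2.2 (lyap z.2.2 ξ.2.2)).1 * (lyap z.2.2 η.2.2).1).trace / 2 := by
  obtain ⟨D, hD, hDX⟩ := hasFDerivAt_trace_lyap z.2.2 ξ.2.2 η.2.2 (lyapOp_isUnit _ hz)
  let π : Ambient m n →L[ℝ] SymMat n :=
    (ContinuousLinearMap.snd ℝ _ _).comp (ContinuousLinearMap.snd ℝ _ _)
  exact ⟨D.comp π, (HasFDerivAt.comp (g := fun T : SymMat n =>
    ((lyap T ξ.2.2).1 * T.1 * (lyap T η.2.2).1).trace) z hD π.hasFDerivAt).const_add _,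
    fun ζ => hDX _⟩

/-- The product metric as a bilinear form. -/
noncomputable def prodMetricBilin (p : Ambient m n × Ambient m n) :
    Ambient m n × Ambient m n →ₗ[ℝ] Ambient m n × Ambient m n →ₗ[ℝ] ℝ :=
  (zMetricBilin p.1).compl₁₂ (LinearMap.fst ℝ _ _) (LinearMap.fst ℝ _ _) +
    (zMetricBilin p.2).compl₁₂ (LinearMap.snd ℝ _ _) (LinearMap.snd ℝ _ _)

theorem zMetric_nonneg (z : Ambient m n) (hz : z ∈ Z m n) (ξ : Ambient m n) :
    0 ≤ zMetric z ξ ξ := by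
  by_cases h : ξ = 0
  · have : zMetric z ξ ξ = zMetricBilin z ξ ξ := rfl
    rw [this, h, map_zero]
  · exact (zMetric_pos z hz ξ h).le

theorem prodMetricBilin_pos (p : Ambient m n × Ambient m n) (hp : p ∈ Z m n ×ˢ Z m n)
    (ξ : Ambient m n × Ambient m n) (hξ : ξ ≠ 0) : 0 < prodMetricBilin p ξ ξ := by
  change 0 < zMetric p.1 ξ.1 ξ.1 + zMetric p.2 ξ.2 ξ.2
  by_cases h1 : ξ.1 = 0
  · have h2 : ξ.2 ≠ 0 := fun h2 => hξ (Prod.ext h1 h2)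
    exact add_pos_of_nonneg_of_pos (zMetric_nonneg _ hp.1 _) (zMetric_pos _ hp.2 _ h2)
  · exact add_pos_of_pos_of_nonneg (zMetric_pos _ hp.1 _ h1) (zMetric_nonneg _ hp.2 _)

theorem fderiv_prodMetric (p ξ η ζ : Ambient m n × Ambient m n) (hp : p ∈ Z m n ×ˢ Z m n) :
    fderiv ℝ (fun q => prodMetric zMetric q ξ η) p ζ =
      -((lyapOp ζ.1.2.2 (lyap p.1.2.2 ξ.1.2.2)).1 * (lyap p.1.2.2 η.1.2.2).1).trace / 2 +
      -((lyapOp ζ.2.2.2 (lyap p.2.2.2 ξ.2.2.2)).1 * (lyap p.2.2.2 η.2.2.2).1).trace / 2 := by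
  obtain ⟨D₁, hD₁, h₁⟩ := hasFDerivAt_zMetric p.1 ξ.1 η.1 hp.1
  obtain ⟨D₂, hD₂, h₂⟩ := hasFDerivAt_zMetric p.2 ξ.2 η.2 hp.2
  have h := (HasFDerivAt.comp (g := fun q => zMetric q ξ.1 η.1) p hD₁
    (hasFDerivAt_fst (𝕜 := ℝ) (p := p))).add
      (HasFDerivAt.comp (g := fun q => zMetric q ξ.2 η.2) p hD₂
        (hasFDerivAt_snd (𝕜 := ℝ) (p := p)))
  have h' : HasFDerivAt (fun q => prodMetric zMetric q ξ η) _ p := h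
  rw [h'.fderiv, ← h₁, ← h₂]
  rfl

/-- The vector `L_Σ[V] Σ L_Σ[V]` in the matrix component. -/
noncomputable def quadVec (z ξ : Ambient m n) : Ambient m n := (0, 0, quadTerm z.2.2 ξ.2.2)

/-- The right side is the diagonal Christoffel symbol of the first kind, `∂_ξ g(ξ, η) - ∂_η g(ξ, ξ)
/ 2`. -/
theorem zMetric_quadVec (z ξ η : Ambient m n) (hz : z ∈ Z m n) :
    zMetric z ((-2 : ℝ) • quadVec z ξ) η =
      -((lyapOp ξ.2.2 (lyap z.2.2 ξ.2.2)).1 * (lyap z.2.2 η.2.2).1).trace / 2 +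
        ((lyapOp η.2.2 (lyap z.2.2 ξ.2.2)).1 * (lyap z.2.2 ξ.2.2).1).trace / 4 := by
  rw [← trace_lyap_quadTerm z.2.2 ξ.2.2 η.2.2 (lyapOp_isUnit _ hz)]
  simp [zMetric, quadVec]

/-- The diagonal suffices, since the Hessian is only evaluated on a velocity paired with itself. -/
theorem christoffel_prodMetric_self (p ξ : Ambient m n × Ambient m n)
    (hp : p ∈ Z m n ×ˢ Z m n) :
    christoffel (prodMetric zMetric) p ξ ξ =
      (-2 : ℝ) • (quadVec p.1 ξ.1, quadVec p.2 ξ.2) := by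
  refine sharp_eq_of_represents _ p (prodMetricBilin p) (fun _ _ => rfl)
    (prodMetricBilin_pos p hp) fun ζ => ?_
  change _ = (fderiv ℝ (fun q => prodMetric zMetric q ξ ζ) p ξ +
    fderiv ℝ (fun q => prodMetric zMetric q ξ ζ) p ξ -
    fderiv ℝ (fun q => prodMetric zMetric q ξ ξ) p ζ) / 2
  rw [fderiv_prodMetric _ _ _ _ hp, fderiv_prodMetric _ _ _ _ hp]
  have h1 := zMetric_quadVec p.1 ξ.1 ζ.1 hp.1
  have h2 := zMetric_quadVec p.2 ξ.2 ζ.2 hp.2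
  change zMetric p.1 ((-2 : ℝ) • quadVec p.1 ξ.1) ζ.1 +
    zMetric p.2 ((-2 : ℝ) • quadVec p.2 ξ.2) ζ.2 = _
  rw [h1, h2]
  ring

end Metric

/-! ### The exponential curves are geodesics -/

section Geodesic

variable {m n : ℕ}

theorem expFactor_smul (S V : SymMat n) (t : ℝ) :
    expFactor S (t • V) = 1 + t • (lyap S V).1 := by
  rw [expFactor, map_smul]; rfl

theorem expFactor_smul_posDef (S V : SymMat n) (h : (expFactor S V).PosDef) {t : ℝ}
    (ht : t ∈ Set.Icc (0 : ℝ) 1) : (expFactor S (t • V)).PosDef := by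
  rcases ht.2.eq_or_lt with rfl | h1
  · rwa [one_smul]
  · have h2 : expFactor S (t • V) = (1 - t) • 1 + t • expFactor S V := by
      rw [expFactor_smul, expFactor, smul_add, sub_smul, one_smul]
      abel
    rw [h2]
    exact (Matrix.PosDef.one.smul (sub_pos.mpr h1)).add_posSemidef (h.posSemidef.smul ht.1)

theorem expMap_coe (z ξ : Ambient m n) :
    (expMap z ξ).2.2.1 = expFactor z.2.2 ξ.2.2 * z.2.2.1 * expFactor z.2.2 ξ.2.2 := rfl

theorem expMap_mem_Z (z ξ : Ambient m n) (hz : z ∈ Z m n) (hξ : ξ ∈ expDomain z) :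
    expMap z ξ ∈ Z m n := by
  change (expFactor z.2.2 ξ.2.2 * z.2.2.1 * expFactor z.2.2 ξ.2.2).PosDef
  have hE : (expFactor z.2.2 ξ.2.2).PosDef := hξ
  have h := (show z.2.2.1.PosDef from hz).conjTranspose_mul_mul_same
    (B := expFactor z.2.2 ξ.2.2) (Matrix.mulVec_injective_of_isUnit hE.isUnit)
  rwa [Matrix.conjTranspose_eq_transpose_of_trivial, (expFactor_isSymm _ _).eq] at h

theorem smul_mem_expDomain (z ξ : Ambient m n) (hξ : ξ ∈ expDomain z) {t : ℝ}
    (ht : t ∈ Set.Icc (0 : ℝ) 1) : t • ξ ∈ expDomain z :=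
  expFactor_smul_posDef _ _ hξ ht

theorem expMap_smul (z ξ : Ambient m n) (hz : z ∈ Z m n) (t : ℝ) :
    expMap z (t • ξ) = z + t • ξ + t ^ 2 • quadVec z ξ := by
  refine Prod.ext (by simp [expMap, quadVec]) (Prod.ext (by simp [expMap, quadVec]) ?_)
  ext1
  change expFactor z.2.2 (t • ξ.2.2) * z.2.2.1 * expFactor z.2.2 (t • ξ.2.2) =
    z.2.2.1 + t • ξ.2.2.1 + t ^ 2 • ((lyap z.2.2 ξ.2.2).1 * z.2.2.1 * (lyap z.2.2 ξ.2.2).1)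
  conv_rhs => rw [← lyap_spec z.2.2 ξ.2.2 hz]
  rw [expFactor_smul]
  simp only [mul_add, add_mul, one_mul, mul_one, Matrix.smul_mul, Matrix.mul_smul, smul_add,
    smul_smul, sq]
  abel

/-- The velocity at time `t` of the geodesic `s ↦ exp_z (s ξ)`. -/
noncomputable def expVelocity (z ξ : Ambient m n) (t : ℝ) : Ambient m n :=
  ξ + (2 * t) • quadVec z ξ

theorem hasDerivAt_expMap_smul (z ξ : Ambient m n) (hz : z ∈ Z m n) (t : ℝ) :
    HasDerivAt (fun s : ℝ => expMap z (s • ξ)) (expVelocity z ξ t) t := by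
  have h1 : (fun s : ℝ => expMap z (s • ξ)) = fun s => z + s • ξ + s ^ 2 • quadVec z ξ :=
    funext fun s => expMap_smul z ξ hz s
  rw [h1]
  exact hasDerivAt_quadratic z ξ _ t

theorem hasDerivAt_expVelocity (z ξ : Ambient m n) (t : ℝ) :
    HasDerivAt (expVelocity z ξ) ((2 : ℝ) • quadVec z ξ) t :=
  hasDerivAt_linear ξ _ t

theorem isUnit_expFactor {z ξ : Ambient m n} (hξ : ξ ∈ expDomain z) :
    IsUnit (expFactor z.2.2 ξ.2.2).det :=
  (Matrix.isUnit_iff_isUnit_det _).mp (Matrix.PosDef.isUnit hξ)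

/-- Along a geodesic, `L_Σ(t)[Σ'(t)] = L (1 + t L)⁻¹`. -/
theorem lyap_expVelocity (z ξ : Ambient m n) (hz : z ∈ Z m n) (t : ℝ)
    (ht : t • ξ ∈ expDomain z) :
    (lyap (expMap z (t • ξ)).2.2 (expVelocity z ξ t).2.2).1 * expFactor z.2.2 (t • ξ).2.2 =
      (lyap z.2.2 ξ.2.2).1 ∧
    expFactor z.2.2 (t • ξ).2.2 * (lyap (expMap z (t • ξ)).2.2 (expVelocity z ξ t).2.2).1 =
      (lyap z.2.2 ξ.2.2).1 := by
  have hE := isUnit_expFactor ht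
  have hV : (expVelocity z ξ t).2.2.1 = ξ.2.2.1 +
    (2 * t) • ((lyap z.2.2 ξ.2.2).1 * z.2.2.1 * (lyap z.2.2 ξ.2.2).1) := rfl
  have hS : (expMap z (t • ξ)).2.2.1 =
    expFactor z.2.2 (t • ξ).2.2 * z.2.2.1 * expFactor z.2.2 (t • ξ).2.2 := rfl
  have hZ := expMap_mem_Z z _ hz ht
  have hEs := expFactor_isSymm z.2.2 (t • ξ).2.2
  have hl := lyap_spec z.2.2 ξ.2.2 hz
  have hLs := (lyap z.2.2 ξ.2.2).isSymm
  have hEL : expFactor z.2.2 (t • ξ).2.2 = 1 + t • (lyap z.2.2 ξ.2.2).1 := expFactor_smul _ _ t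
  generalize hEdef : expFactor z.2.2 (t • ξ).2.2 = E at *
  generalize (lyap z.2.2 ξ.2.2).1 = L at *
  -- `E = 1 + tL` commutes with `L`, so `L * E⁻¹` is symmetric and can be a Lyapunov solution.
  have hcomm : E * L = L * E := by simp [hEL, mul_add, add_mul]
  have hinv : E⁻¹ * L = L * E⁻¹ := by
    calc E⁻¹ * L = E⁻¹ * (L * E) * E⁻¹ := by
          rw [Matrix.mul_assoc, Matrix.mul_nonsing_inv_cancel_right _ _ hE]
      _ = L * E⁻¹ := by rw [← hcomm, Matrix.nonsing_inv_mul_cancel_left _ _ hE]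
  let H : SymMat n := ⟨L * E⁻¹, by
    change (L * E⁻¹).transpose = _
    rw [Matrix.transpose_mul, Matrix.transpose_nonsing_inv, hEs.eq, hLs.eq, hinv]⟩
  have h1 : H.1 * E = L := Matrix.nonsing_inv_mul_cancel_right _ _ hE
  have h2 : E * H.1 = L := by
    change E * (L * E⁻¹) = L
    rw [← hinv, Matrix.mul_nonsing_inv_cancel_left _ _ hE]
  have hH : H = lyap (expMap z (t • ξ)).2.2 (expVelocity z ξ t).2.2 := by
    -- With `HE = EH = L`, the Lyapunov sum for `EΣE` is `LΣE + EΣL = V + 2t LΣL`, which is the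
    -- velocity.
    refine lyap_unique _ _ _ hZ ?_
    rw [hV, hS, ← Matrix.mul_assoc, ← Matrix.mul_assoc, h1, Matrix.mul_assoc _ E H.1, h2, hEL,
      ← hl]
    simp only [mul_add, add_mul, one_mul, mul_one, Matrix.smul_mul, Matrix.mul_smul, two_mul,
      add_smul]
    abel
  rw [← hH]
  exact ⟨h1, h2⟩

/-- `t ↦ exp_z (t ξ)` satisfies the geodesic equation. -/
theorem quadVec_expVelocity (z ξ : Ambient m n) (hz : z ∈ Z m n) (t : ℝ)
    (ht : t • ξ ∈ expDomain z) :
    quadVec (expMap z (t • ξ)) (expVelocity z ξ t) = quadVec z ξ := by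
  obtain ⟨h1, h2⟩ := lyap_expVelocity z ξ hz t ht
  have h : quadTerm (expMap z (t • ξ)).2.2 (expVelocity z ξ t).2.2 = quadTerm z.2.2 ξ.2.2 := by
    ext1
    -- Regrouping: `H (EΣE) H = (HE) Σ (EH) = LΣL`.
    rw [quadTerm_coe, quadTerm_coe, expMap_coe, ← Matrix.mul_assoc, ← Matrix.mul_assoc, h1,
      Matrix.mul_assoc, h2]
  rw [quadVec, h, quadVec]

theorem zMetric_self (z ξ : Ambient m n) :
    zMetric z ξ ξ = inner ℝ ξ.1 ξ.1 + inner ℝ ξ.2.1 ξ.2.1 +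
      Matrix.trace (quadVec z ξ).2.2.1 := rfl

/-- Geodesics have constant speed. -/
theorem zMetric_expVelocity (z ξ : Ambient m n) (hz : z ∈ Z m n) (t : ℝ)
    (ht : t • ξ ∈ expDomain z) :
    zMetric (expMap z (t • ξ)) (expVelocity z ξ t) (expVelocity z ξ t) = zMetric z ξ ξ := by
  rw [zMetric_self, quadVec_expVelocity z ξ hz t ht, zMetric_self]
  simp [expVelocity, quadVec]

end Geodesic

/-! ### Taylor estimate for the kernel -/

section Kernel

variable {m n : ℕ}

theorem zMetric_riemGrad (f : Ambient m n → ℝ) (z ξ : Ambient m n) (hz : z ∈ Z m n) :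
    zMetric z (riemGrad zMetric f z) ξ = fderiv ℝ f z ξ :=
  (sharp_spec zMetric z (zMetricBilin z) (fun _ _ => rfl) (zMetric_pos z hz)
    (fderiv ℝ f z).toLinearMap).1 ξ

/-- The second-order Taylor estimate for a function on `[0, 1]` with bounded second derivative. -/
theorem abs_taylor_le {f f' f'' : ℝ → ℝ} {C : ℝ}
    (hf : ∀ t ∈ Set.Icc (0 : ℝ) 1, HasDerivAt f (f' t) t)
    (hf' : ∀ t ∈ Set.Icc (0 : ℝ) 1, HasDerivAt f' (f'' t) t)
    (hC : ∀ t ∈ Set.Icc (0 : ℝ) 1, |f'' t| ≤ C) : |f 1 - f 0 - f' 0| ≤ C / 2 := by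
  have h1 : ∀ t ∈ Set.Icc (0 : ℝ) 1, |f' t - f' 0| ≤ C * t := by
    intro t ht
    have := norm_image_sub_le_of_norm_deriv_le_segment'
      (fun x hx => (hf' x hx).hasDerivWithinAt) (fun x hx => hC x (Set.Ico_subset_Icc_self hx))
      t ht
    simpa using this
  have h2 : ∀ t ∈ Set.Icc (0 : ℝ) 1,
      HasDerivAt (fun s => f s - f 0 - s * f' 0) (f' t - f' 0) t := by
    intro t ht
    have h : HasDerivAt (fun s => f s - f 0 - s * f' 0) _ t :=
      ((hf t ht).sub_const (f 0)).sub ((hasDerivAt_id t).mul_const (f' 0))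
    exact h.congr_deriv (by simp)
  have h3 : ∀ t : ℝ, HasDerivAt (fun s => C * s ^ 2 / 2) (C * t) t := by
    intro t
    exact (((hasDerivAt_pow 2 t).const_mul C).div_const 2).congr_deriv (by push_cast; ring)
  -- Comparing with `C t² / 2`, rather than using a constant bound on the derivative, gains the
  -- factor `1 / 2`.
  have h4 := image_norm_le_of_norm_deriv_right_le_deriv_boundary
    (fun t ht => (h2 t ht).continuousAt.continuousWithinAt)
    (fun t ht => (h2 t (Set.Ico_subset_Icc_self ht)).hasDerivWithinAt)
    (B := fun s => C * s ^ 2 / 2) (by simp) h3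
    (fun t ht => h1 t (Set.Ico_subset_Icc_self ht)) (Set.right_mem_Icc.mpr zero_le_one)
  simpa using h4

section Chart

variable {F : Type*} [NormedAddCommGroup F] [NormedSpace ℝ F]

theorem hasDerivAt_comp_curve {f : F → ℝ} {c c' : ℝ → F} {t : ℝ}
    (hf : DifferentiableAt ℝ f (c t)) (hc : HasDerivAt c (c' t) t) :
    HasDerivAt (fun s => f (c s)) (fderiv ℝ f (c t) (c' t)) t :=
  hf.hasFDerivAt.comp_hasDerivAt t hc

theorem hasDerivAt_fderiv_comp_curve {f : F → ℝ} {c c' : ℝ → F} {a : F} {t : ℝ}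
    (hf : DifferentiableAt ℝ (fderiv ℝ f) (c t)) (hc : HasDerivAt c (c' t) t)
    (hc' : HasDerivAt c' a t) :
    HasDerivAt (fun s => fderiv ℝ f (c s) (c' s))
      (fderiv ℝ (fderiv ℝ f) (c t) (c' t) (c' t) + fderiv ℝ f (c t) a) t :=
  (hf.hasFDerivAt.comp_hasDerivAt t hc).clm_apply hc'

theorem fderiv_uncurry_apply {k : F → F → ℝ} {z w ξ η : F}
    (hk : DifferentiableAt ℝ (Function.uncurry k) (z, w)) :
    fderiv ℝ (Function.uncurry k) (z, w) (ξ, η) =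
      fderiv ℝ (fun z' => k z' w) z ξ + fderiv ℝ (fun w' => k z w') w η := by
  have h1 := HasFDerivAt.comp (f := fun e => (e, w)) z hk.hasFDerivAt
    (hasFDerivAt_prodMk_left z w)
  have h2 := HasFDerivAt.comp (f := fun e => (z, e)) w hk.hasFDerivAt
    (hasFDerivAt_prodMk_right z w)
  have h1' : fderiv ℝ (fun z' => k z' w) z = _ := h1.fderiv
  have h2' : fderiv ℝ (fun w' => k z w') w = _ := h2.fderiv
  rw [h1', h2']
  simp [← map_add]

/-- `hΓ` together with the acceleration `2X` is the geodesic equation, so `(f ∘ c)''` is the Hessian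
on `c'`, at most `M * C` by constant speed. -/
theorem TwiceDifferentiableOn.abs_taylor_le {f : F → ℝ} {s : Set F}
    (hf : TwiceDifferentiableOn f s) {g : F → F → F → ℝ} {M C : ℝ}
    (hM : HessianBoundedOn g f s M) {c c' : ℝ → F} {X : F}
    (hcs : ∀ t ∈ Set.Icc (0 : ℝ) 1, c t ∈ s)
    (hc : ∀ t, HasDerivAt c (c' t) t) (hc' : ∀ t, HasDerivAt c' ((2 : ℝ) • X) t)
    (hΓ : ∀ t ∈ Set.Icc (0 : ℝ) 1, christoffel g (c t) (c' t) (c' t) = (-2 : ℝ) • X)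
    (hspeed : ∀ t ∈ Set.Icc (0 : ℝ) 1, g (c t) (c' t) (c' t) = C) (hC : 0 ≤ C) :
    |f (c 1) - f (c 0) - fderiv ℝ f (c 0) (c' 0)| ≤ M / 2 * C := by
  have h := BuresKernel.abs_taylor_le (C := M * C)
    (fun t ht => hasDerivAt_comp_curve (hf _ (hcs t ht)).1 (hc t))
    (fun t ht => hasDerivAt_fderiv_comp_curve (hf _ (hcs t ht)).2 (hc t) (hc' t))
    fun t ht => ?_
  · linarith
  · rw [← riemHess_eq_of_christoffel_eq (hΓ t ht) f]
    refine (hM _ (hcs t ht) _ _).trans ?_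
    rw [mul_assoc, tnorm, hspeed t ht, Real.mul_self_sqrt hC]

end Chart

theorem taylor_expMap {k : Ambient m n → Ambient m n → ℝ}
    (hdiff : TwiceDifferentiableOn (Function.uncurry k) (Z m n ×ˢ Z m n)) {M : ℝ}
    (hM : HessianBoundedOn (prodMetric zMetric) (Function.uncurry k) (Z m n ×ˢ Z m n) M)
    {z w ξ η : Ambient m n} (hz : z ∈ Z m n) (hw : w ∈ Z m n) (hξ : ξ ∈ expDomain z)
    (hη : η ∈ expDomain w) :
    |k (expMap z ξ) (expMap w η) - k z w -
        (zMetric z (riemGrad zMetric (fun z' => k z' w) z) ξ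
          + zMetric w (riemGrad zMetric (fun w' => k z w') w) η)|
      ≤ M / 2 * (tnorm zMetric z ξ ^ 2 + tnorm zMetric w η ^ 2) := by
  have hz0 := zMetric_nonneg z hz ξ
  have hw0 := zMetric_nonneg w hw η
  rw [zMetric_riemGrad _ _ _ hz, zMetric_riemGrad _ _ _ hw, tnorm, tnorm, Real.sq_sqrt hz0,
    Real.sq_sqrt hw0]
  have hgrad := fderiv_uncurry_apply (ξ := ξ) (η := η) (hdiff (z, w) ⟨hz, hw⟩).1
  have hmem : ∀ t ∈ Set.Icc (0 : ℝ) 1,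
      (expMap z (t • ξ), expMap w (t • η)) ∈ Z m n ×ˢ Z m n := fun t ht =>
    ⟨expMap_mem_Z z _ hz (smul_mem_expDomain z ξ hξ ht),
      expMap_mem_Z w _ hw (smul_mem_expDomain w η hη ht)⟩
  have h := hdiff.abs_taylor_le hM (C := zMetric z ξ ξ + zMetric w η η)
    (c := fun t => (expMap z (t • ξ), expMap w (t • η)))
    (c' := fun t => (expVelocity z ξ t, expVelocity w η t)) (X := (quadVec z ξ, quadVec w η))
    hmem
    (fun t => (hasDerivAt_expMap_smul z ξ hz t).prodMk (hasDerivAt_expMap_smul w η hw t))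
    (fun t => (hasDerivAt_expVelocity z ξ t).prodMk (hasDerivAt_expVelocity w η t))
    (fun t ht => by
      have := christoffel_prodMetric_self _ (expVelocity z ξ t, expVelocity w η t) (hmem t ht)
      rwa [quadVec_expVelocity z ξ hz t (smul_mem_expDomain z ξ hξ ht),
        quadVec_expVelocity w η hw t (smul_mem_expDomain w η hη ht)] at this)
    (fun t ht => congrArg₂ (· + ·)
      (zMetric_expVelocity z ξ hz t (smul_mem_expDomain z ξ hξ ht))
      (zMetric_expVelocity w η hw t (smul_mem_expDomain w η hη ht)))
    (add_nonneg hz0 hw0)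
  have e (z ξ : Ambient m n) (hz : z ∈ Z m n) : expMap z ((0 : ℝ) • ξ) = z := by
    rw [expMap_smul z ξ hz]; simp
  have e' (z ξ : Ambient m n) : expVelocity z ξ 0 = ξ := by simp [expVelocity]
  simp only [e z ξ hz, e w η hw, e', one_smul, Function.uncurry_apply_pair] at h
  refine le_of_eq_of_le (congrArg (fun a => |k (expMap z ξ) (expMap w η) - k z w - a|) ?_) h
  exact hgrad.symm

theorem isLipschitzGradientKernel_of_hessianBoundedOn {k : Ambient m n → Ambient m n → ℝ}
    (hdiff : TwiceDifferentiableOn (Function.uncurry k) (Z m n ×ˢ Z m n)) {M : ℝ} (hM0 : 0 < M)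
    (hM : HessianBoundedOn (prodMetric zMetric) (Function.uncurry k) (Z m n ×ˢ Z m n) M) :
    IsLipschitzGradientKernel k (M / 2) :=
  -- Any `ε₀` in `(0, 1)` works: `taylor_expMap` holds on the whole exponential domain, without
  -- smallness.
  ⟨half_pos hM0, fun p hp => (hdiff p hp).1, 1 / 2, by norm_num,
    fun _ _ _ _ _ _ _ hz _ hw hξ hη => taylor_expMap hdiff hM hz hw hξ hη⟩

end Kernel

end BuresKernel

theorem mainTheorem9 (m n : ℕ) (k : Ambient m n → Ambient m n → ℝ)
    (hk : IsPositiveDefiniteKernel k)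
    (hdiff : TwiceDifferentiableOn (Function.uncurry k) (Z m n ×ˢ Z m n))
    (M : ℝ)
    (hM : HessianBoundedOn (prodMetric zMetric) (Function.uncurry k) (Z m n ×ˢ Z m n) M) :
    (∃ L : ℝ, IsLipschitzGradientKernel k L) ∧
      (0 < M → IsLipschitzGradientKernel k (M / 2)) := by
  -- `M` may be zero or negative, while the constant must be positive; enlarging `M` to `max M 1`
  -- keeps the Hessian bound.
  refine ⟨⟨max M 1 / 2, isLipschitzGradientKernel_of_hessianBoundedOn hdiff
    (lt_max_of_lt_right one_pos) fun p hp ξ η => (hM p hp ξ η).trans ?_⟩,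
    fun hM0 => isLipschitzGradientKernel_of_hessianBoundedOn hdiff hM0 hM⟩
  exact mul_le_mul_of_nonneg_right
    (mul_le_mul_of_nonneg_right (le_max_left _ _) (Real.sqrt_nonneg _)) (Real.sqrt_nonneg _)
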